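/- For $\alpha,\beta>0$ let $p_{\alpha,\beta}$ be the Pareto density on $\mathbb R$, $p_{\alpha,\beta}(x)=\beta\alpha^\beta/x^{\beta+1}$ for $x\ge\alpha$ and $p_{\alpha,\beta}(x)=0$ for $x<\alpha$. Let $P=\{p_{\alpha,\beta}\mid \alpha,\beta>0\}$, a smooth manifold with global coordinates $\theta=(\theta^1,\theta^2)=(\alpha,\beta)\in(0,\infty)^2$, equipped with the Fisher–Rao metric \[ g=\sum_{i,j=1}^2 g_{ij}\,\mathrm d\theta^i\otimes \mathrm d\theta^j,\qquad g_{ij}(\theta)=\int_{\mathbb R} \frac{\partial \log p_\theta(x)}{\partial\theta^i}\,\frac{\partial \log p_\theta(x)}{\partial\theta^j}\,p_\theta(x)\,\mathrm dx \] (the integrand is taken to be $0$ where $p_\theta(x)=0$). Let $H=\{(x,y)\in\mathbb R^2\mid y>0\}$ carry the Poincaré metric $h=(\mathrm dx\otimes\mathrm dx+\mathrm dy\otimes\mathrm dy)/y^2$. The geodesic distance between two points of a Riemannian manifold is the infimum of the lengths of $C^1$ paths joining them; denote it by $d$ on $(P,g)$ and by $d_H$ on $(H,h)$. Then the integrals $g_{ij}(\theta)$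 converge absolutely, and the map $F:P\to H$, $F(p_{\alpha,\beta})=(\log\alpha,1/\beta)$, is a smooth diffeomorphism with $F^*h=g$. For all $\alpha_0,\beta_0,\alpha_1,\beta_1>0$, \[ d(p_{\alpha_0,\beta_0},p_{\alpha_1,\beta_1})=d_H\bigl(F(p_{\alpha_0,\beta_0}),F(p_{\alpha_1,\beta_1})\bigr)=\operatorname{arcosh}\left(1+\frac{\beta_0\beta_1(\log\alpha_0-\log\alpha_1)^2}{2}+\frac{(\beta_0-\beta_1)^2}{2\beta_0\beta_1}\right). \] -/

import Mathlib

open Set Topology MeasureTheory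
open scoped Manifold ContDiff ENNReal UpperHalfPlane

noncomputable section

/-! ### The Fisher–Rao matrix of a parametric family -/

/-- The integrand `∂ᵢ l(x | θ) · ∂ⱼ l(x | θ) · p(x | θ)` of the `(i, j)` entry of the Fisher–Rao
matrix, where `l = log p` and `∂ᵢ` is the partial derivative in the `i`-th parameter. -/
def fisherRaoIntegrand {m : ℕ} (p : EuclideanSpace ℝ (Fin m) → ℝ → ℝ)
    (θ : EuclideanSpace ℝ (Fin m)) (i j : Fin m) (x : ℝ) : ℝ :=
  lineDeriv ℝ (fun η => Real.log (p η x)) θ (EuclideanSpace.single i 1) *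
    lineDeriv ℝ (fun η => Real.log (p η x)) θ (EuclideanSpace.single j 1) * p θ x

/-- The Fisher–Rao matrix `gᵢⱼ(θ) = E[∂ᵢ l(X | θ) ∂ⱼ l(X | θ)]`. -/
def fisherRaoMatrix {m : ℕ} (p : EuclideanSpace ℝ (Fin m) → ℝ → ℝ)
    (θ : EuclideanSpace ℝ (Fin m)) : Matrix (Fin m) (Fin m) ℝ :=
  Matrix.of fun i j => ∫ x, fisherRaoIntegrand p θ i j x

/-! ### The manifold of Pareto densities -/

/-- The density `p(x | α, β) = β α ^ β / x ^ (β + 1)` for `x ≥ α` and `0` for `x < α`, as a function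
of the parameter vector `θ = (α, β)`. -/
def paretoDensity (θ : EuclideanSpace ℝ (Fin 2)) : ℝ → ℝ :=
  ProbabilityTheory.paretoPDFReal (θ 0) (θ 1)

/-- The open parameter space `α > 0`, `β > 0`. -/
def paretoParams : Set (EuclideanSpace ℝ (Fin 2)) := {θ | 0 < θ 0 ∧ 0 < θ 1}

/-- The set `P = {p_{α, β} | α > 0, β > 0}` of all Pareto densities. It is a type of its own, so
that it does not inherit the topology of pointwise convergence. -/
def ParetoFamily : Type := {f : ℝ → ℝ // ∃ θ ∈ paretoParams, paretoDensity θ = f}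

/-- The element `p_{α, β}` of the Pareto family. -/
def pareto (α β : ℝ) (hα : 0 < α) (hβ : 0 < β) : ParetoFamily :=
  ⟨paretoDensity !₂[α, β], !₂[α, β], by simpa [paretoParams] using ⟨hα, hβ⟩, rfl⟩

/-- Different parameters give different Pareto densities. -/
theorem injOn_paretoDensity : InjOn paretoDensity paretoParams := by
  have key : ∀ θ ∈ paretoParams, ∀ η ∈ paretoParams, paretoDensity θ = paretoDensity η →
      η 0 ≤ θ 0 := by
    intro θ hθ η hη h
    by_contra hlt
    have h1 := ProbabilityTheory.paretoPDFReal_pos hθ.1 hθ.2 le_rfl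
    have h2 := congrFun h (θ 0)
    simp only [paretoDensity] at h2
    rw [h2, ProbabilityTheory.paretoPDFReal, if_neg hlt] at h1
    exact lt_irrefl _ h1
  have val : ∀ a b : ℝ, 0 < a → ProbabilityTheory.paretoPDFReal a b a = b / a := by
    intro a b ha
    rw [ProbabilityTheory.paretoPDFReal, if_pos le_rfl, mul_assoc, ← Real.rpow_add ha]
    rw [show b + -(b + 1) = -1 by ring, Real.rpow_neg_one, div_eq_mul_inv]
  intro θ hθ η hη h
  have h0 : θ 0 = η 0 := le_antisymm (key η hη θ hθ h.symm) (key θ hθ η hη h)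
  have h1 : θ 1 = η 1 := by
    have h2 := congrFun h (θ 0)
    simp only [paretoDensity] at h2
    rw [val _ _ hθ.1, h0, val _ _ hη.1] at h2
    exact (div_left_inj' hη.1.ne').1 h2
  ext i
  fin_cases i
  · exact h0
  · exact h1

namespace ParetoFamily

/-- The global coordinates `p_{α, β} ↦ (α, β)`. -/
def coords (p : ParetoFamily) : EuclideanSpace ℝ (Fin 2) := p.2.choose

theorem coords_mem (p : ParetoFamily) : p.coords ∈ paretoParams := p.2.choose_spec.1

theorem paretoDensity_coords (p : ParetoFamily) : paretoDensity p.coords = p.1 :=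
  p.2.choose_spec.2

theorem coords_injective : Function.Injective coords := fun p q h =>
  Subtype.ext (by rw [← paretoDensity_coords p, h, paretoDensity_coords q])

theorem range_coords : range coords = paretoParams := by
  refine Subset.antisymm (range_subset_iff.2 coords_mem) fun θ hθ => ?_
  exact ⟨⟨paretoDensity θ, θ, hθ, rfl⟩,
    injOn_paretoDensity (coords_mem _) hθ (paretoDensity_coords _)⟩

theorem coords_pareto (α β : ℝ) (hα : 0 < α) (hβ : 0 < β) :
    (pareto α β hα hβ).coords = !₂[α, β] :=
  injOn_paretoDensity (coords_mem _) (by simpa [paretoParams] using ⟨hα, hβ⟩)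
    (paretoDensity_coords _)

/-- The topology of the Pareto family is that of its parameter space. -/
instance : TopologicalSpace ParetoFamily := TopologicalSpace.induced coords inferInstance

theorem isOpenEmbedding_coords : IsOpenEmbedding coords where
  eq_induced := rfl
  injective := coords_injective
  isOpen_range := by
    rw [range_coords]
    have h (i : Fin 2) : Continuous fun θ : EuclideanSpace ℝ (Fin 2) => θ i := by fun_prop
    exact (isOpen_lt continuous_const (h 0)).inter (isOpen_lt continuous_const (h 1))

instance : Nonempty ParetoFamily := ⟨pareto 1 1 one_pos one_pos⟩

/-- The smooth structure of the Pareto family, with the single chart `(α, β)`. -/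
instance : ChartedSpace (EuclideanSpace ℝ (Fin 2)) ParetoFamily :=
  isOpenEmbedding_coords.singletonChartedSpace

instance : IsManifold 𝓘(ℝ, EuclideanSpace ℝ (Fin 2)) ∞ ParetoFamily :=
  isOpenEmbedding_coords.isManifold_singleton

end ParetoFamily

/-- The components of a tangent vector in the frame `∂/∂α, ∂/∂β` of the global chart. -/
def ParetoFamily.tangentCoords {p : ParetoFamily}
    (v : TangentSpace 𝓘(ℝ, EuclideanSpace ℝ (Fin 2)) p) : EuclideanSpace ℝ (Fin 2) := v

/-- The Fisher–Rao metric `g = ∑ᵢⱼ gᵢⱼ dθⁱ ⊗ dθʲ` on the manifold of Pareto densities. -/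
def fisherRaoForm (p : ParetoFamily)
    (v w : TangentSpace 𝓘(ℝ, EuclideanSpace ℝ (Fin 2)) p) : ℝ :=
  ∑ i, ∑ j, fisherRaoMatrix paretoDensity p.coords i j *
    ParetoFamily.tangentCoords v i * ParetoFamily.tangentCoords w j

/-! ### The Poincaré upper half-plane -/

/-- The components of a tangent vector of the upper half-plane, as the complex number
`dx(v) + i dy(v)`. -/
def halfPlaneTangentCoords {z : ℍ} (v : TangentSpace 𝓘(ℝ, ℂ) z) : ℂ := v

/-- The Poincaré metric `h = (dx ⊗ dx + dy ⊗ dy) / y ^ 2`. -/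
def poincareForm (z : ℍ) (v w : TangentSpace 𝓘(ℝ, ℂ) z) : ℝ :=
  ((halfPlaneTangentCoords v).re * (halfPlaneTangentCoords w).re +
    (halfPlaneTangentCoords v).im * (halfPlaneTangentCoords w).im) / z.im ^ 2

/-! ### Geodesic distance -/

/-- The geodesic distance of a Riemannian metric `g`: the infimum of the lengths of `C¹` paths
from `x` to `y`, where the length of a path is the integral of `√(g(γ', γ'))`. -/
def geodesicEDist {E H M : Type*} [NormedAddCommGroup E] [NormedSpace ℝ E] [TopologicalSpace H]
    (I : ModelWithCorners ℝ E H) [TopologicalSpace M] [ChartedSpace H M]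
    (g : ∀ x : M, TangentSpace I x → TangentSpace I x → ℝ) (x y : M) : ℝ≥0∞ :=
  letI : ∀ x : M, ENorm (TangentSpace I x) := fun x => ⟨fun v => ENNReal.ofReal √(g x v v)⟩
  Manifold.riemannianEDist I x y

end

/-! With `u = log x - log α` the Pareto density becomes the exponential law with rate `β` in `u`.
For `x > α` the score is `β / α` in the direction of `α` and `1/β - u` in the direction of `β`.
Hence the Fisher–Rao metric is `(β² / α²) dα² + (1 / β²) dβ²` (`fisherRaoMatrix_paretoDensity`). For
`x = log α`, `y = 1/β` one has `dx = dα / α`, `dy = -dβ / β²`, so this is exactly `(dx² + dy²) /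
y²`.

Everything about distances rests on one principle: a `C¹` map that does not lengthen tangent vectors
does not increase geodesic distance (`geodesicEDist_le_of_mfderiv_le`). Applied to the
diffeomorphism and to its inverse, it gives the equality of the two distances.

Applied to maps between `ℝ` and the half-plane, it computes `d_H` by calibration
(`geodesicEDist_poincareForm_of_calibration`). A unit speed curve `Φ : ℝ → ℍ` bounds the distance
from above; a function `φ : ℍ → ℝ` with gradient at most one and `φ ∘ Φ = id` bounds it from below.
Any two points lie on a vertical half-line or on a half-circle centred on the real axis, and both
kinds of curve are calibrated explicitly. -/

noncomputable section

/-! ### Charts given by an open embedding -/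

/-- In a manifold whose charts are given by an open embedding into the model vector space, the
derivative of the embedding is the identity. -/
theorem Topology.IsOpenEmbedding.hasMFDerivAt {E M : Type*} [NormedAddCommGroup E]
    [NormedSpace ℝ E] [TopologicalSpace M] [Nonempty M] {e : M → E} (he : IsOpenEmbedding e)
    (x : M) :
    letI := he.singletonChartedSpace
    HasMFDerivAt 𝓘(ℝ, E) 𝓘(ℝ, E) e x (ContinuousLinearMap.id ℝ E) := by
  let _ := he.singletonChartedSpace
  refine ⟨he.continuous.continuousAt, ?_⟩
  have hx : extChartAt 𝓘(ℝ, E) x x = e x := by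
    simp [mfld_simps]
  -- The chart is `e` itself, so in charts `e` reads `e ∘ e⁻¹`, which is the identity only on the
  -- open range of `e`.
  have h : writtenInExtChartAt 𝓘(ℝ, E) 𝓘(ℝ, E) x e =ᶠ[𝓝 (e x)] id := by
    filter_upwards [he.isOpen_range.mem_nhds (mem_range_self x)] with y hy
    exact he.toOpenPartialHomeomorph_right_inv e hy
  rw [hx]
  exact ((hasFDerivAt_id (𝕜 := ℝ) (e x)).congr_of_eventuallyEq h).hasFDerivWithinAt

/-! ### Geodesic distances and contractions -/

section Contraction

variable {E H M E' H' M' : Type*} [NormedAddCommGroup E] [NormedSpace ℝ E] [TopologicalSpace H]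
  {I : ModelWithCorners ℝ E H} [TopologicalSpace M] [ChartedSpace H M]
  [NormedAddCommGroup E'] [NormedSpace ℝ E'] [TopologicalSpace H']
  {J : ModelWithCorners ℝ E' H'} [TopologicalSpace M'] [ChartedSpace H' M']

theorem geodesicEDist_eq (g : ∀ x : M, TangentSpace I x → TangentSpace I x → ℝ) (x y : M) :
    geodesicEDist I g x y = ⨅ (γ : Path x y) (_ : ContMDiff (𝓡∂ 1) I 1 γ),
      ∫⁻ t, ENNReal.ofReal √(g (γ t) (mfderiv (𝓡∂ 1) I γ t 1) (mfderiv (𝓡∂ 1) I γ t 1)) := by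
  rw [geodesicEDist, Manifold.riemannianEDist]
  rfl

/-- A `C¹` map that does not increase the lengths of tangent vectors does not increase geodesic
distances. -/
theorem geodesicEDist_le_of_mfderiv_le
    (g : ∀ x : M, TangentSpace I x → TangentSpace I x → ℝ)
    (h : ∀ x : M', TangentSpace J x → TangentSpace J x → ℝ) {F : M → M'} (hF : ContMDiff I J 1 F)
    (hle : ∀ x (v : TangentSpace I x), h (F x) (mfderiv I J F x v) (mfderiv I J F x v) ≤ g x v v)
    (x y : M) : geodesicEDist J h (F x) (F y) ≤ geodesicEDist I g x y := by
  rw [geodesicEDist_eq, geodesicEDist_eq]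
  refine le_iInf₂ fun γ hγ => ?_
  refine (iInf₂_le (γ.map hF.continuous) (hF.comp hγ)).trans (lintegral_mono fun t => ?_)
  have hd : mfderiv (𝓡∂ 1) J (γ.map hF.continuous) t =
      (mfderiv I J F (γ t)).comp (mfderiv (𝓡∂ 1) I γ t) :=
    mfderiv_comp t (hF.mdifferentiableAt one_ne_zero) (hγ.mdifferentiableAt one_ne_zero)
  rw [hd]
  exact ENNReal.ofReal_le_ofReal (Real.sqrt_le_sqrt (hle _ _))

end Contraction

/-- The Euclidean metric on the real line. -/
def realForm (x : ℝ) (v w : TangentSpace 𝓘(ℝ, ℝ) x) : ℝ :=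
  (show ℝ from v) * (show ℝ from w)

/-- The distance of `ℝ` is already known to be its Riemannian distance; what remains is that `√(v *
v)` is the norm of `v`. The line is the model against which curves in the half-plane are measured.
-/
theorem geodesicEDist_realForm (x y : ℝ) : geodesicEDist 𝓘(ℝ, ℝ) realForm x y = edist x y := by
  rw [IsRiemannianManifold.out (I := 𝓘(ℝ, ℝ)) x y, geodesicEDist]
  congr 1
  funext z
  refine congrArg ENorm.mk (funext fun v => ?_)
  refine Eq.trans ?_ (enorm_tangentSpace_vectorSpace (v := v)).symm
  have h (v : ℝ) : ENNReal.ofReal √(v * v) = ‖v‖ₑ := by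
    rw [Real.sqrt_mul_self_eq_abs, Real.enorm_eq_ofReal_abs]
  exact h v

/-! ### The Fisher–Rao matrix of the Pareto family -/

section FisherRao

open ProbabilityTheory Filter

theorem paretoPDFReal_eq_exp {α β x : ℝ} (hα : 0 < α) (hx : α ≤ x) :
    paretoPDFReal α β x = β / x * Real.exp (-β * (Real.log x - Real.log α)) := by
  have h0 : 0 < x := hα.trans_le hx
  rw [paretoPDFReal, if_pos hx, Real.rpow_def_of_pos hα, Real.rpow_def_of_pos h0, mul_assoc,
    ← Real.exp_add, show Real.log α * β + Real.log x * -(β + 1) =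
      -β * (Real.log x - Real.log α) - Real.log x by ring, Real.exp_sub, Real.exp_log h0]
  ring

theorem log_paretoPDFReal {α β x : ℝ} (hα : 0 < α) (hβ : 0 < β) (hx : α ≤ x) :
    Real.log (paretoPDFReal α β x) =
      Real.log β - Real.log x - β * (Real.log x - Real.log α) := by
  have h0 : 0 < x := hα.trans_le hx
  rw [paretoPDFReal_eq_exp hα hx, Real.log_mul (by positivity) (Real.exp_pos _).ne',
    Real.log_div hβ.ne' h0.ne', Real.log_exp]
  ring

/-- The score `∂ᵢ l(x | θ)` of the Pareto family for `x > α`. -/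
def paretoScore (α β : ℝ) (i : Fin 2) (x : ℝ) : ℝ :=
  ![β / α, 1 / β - (Real.log x - Real.log α)] i

/-- Strictness of `α < x` keeps `x` in the support for all nearby parameters, so the closed form of
the log density may be differentiated. -/
theorem lineDeriv_log_paretoDensity {α β x : ℝ} (hα : 0 < α) (hβ : 0 < β) (hx : α < x)
    (i : Fin 2) :
    lineDeriv ℝ (fun η => Real.log (paretoDensity η x)) !₂[α, β] (EuclideanSpace.single i 1) =
      paretoScore α β i x := by
  -- One computation along an arbitrary curve of parameters through `(α, β)` serves both coordinate
  -- directions.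
  have hev (a b : ℝ → ℝ) (a' b' : ℝ) (ha : HasDerivAt a a' 0) (hb : HasDerivAt b b' 0)
      (ha0 : a 0 = α) (hb0 : b 0 = β) :
      deriv (fun t => Real.log (paretoPDFReal (a t) (b t) x)) 0 =
        b' / β - (b' * (Real.log x - Real.log α) + β * -(a' / α)) := by
    have h1 : ∀ᶠ t in 𝓝 (0 : ℝ), 0 < a t :=
      ha.continuousAt.eventually (lt_mem_nhds (by rwa [ha0]))
    have h2 : ∀ᶠ t in 𝓝 (0 : ℝ), a t < x :=
      ha.continuousAt.eventually (gt_mem_nhds (by rwa [ha0]))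
    have h3 : ∀ᶠ t in 𝓝 (0 : ℝ), 0 < b t :=
      hb.continuousAt.eventually (lt_mem_nhds (by rwa [hb0]))
    have heq : (fun t => Real.log (paretoPDFReal (a t) (b t) x)) =ᶠ[𝓝 0]
        fun t => Real.log (b t) - Real.log x - b t * (Real.log x - Real.log (a t)) := by
      filter_upwards [h1, h2, h3] with t h1 h2 h3 using log_paretoPDFReal h1 h3 h2.le
    rw [heq.deriv_eq]
    have hda := ha.log (by rw [ha0]; exact hα.ne')
    have hdb := hb.log (by rw [hb0]; exact hβ.ne')
    have := (hdb.sub_const (Real.log x)).sub (hb.mul (hda.const_sub (Real.log x)))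
    rw [ha0, hb0] at this
    exact this.deriv
  have hid (c : ℝ) : HasDerivAt (fun t : ℝ => c + t) 1 0 := (hasDerivAt_id (0 : ℝ)).const_add c
  fin_cases i
  · have := hev (fun t => α + t) (fun _ => β) 1 0 (hid α) (hasDerivAt_const _ _) (by simp) rfl
    simp only [lineDeriv, paretoDensity]
    simp only [PiLp.add_apply, PiLp.smul_apply]
    simp [paretoScore] at this ⊢
    rw [this]; ring
  · have := hev (fun _ => α) (fun t => β + t) 0 1 (hasDerivAt_const _ _) (hid β) rfl (by simp)
    simp only [lineDeriv, paretoDensity]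
    simp only [PiLp.add_apply, PiLp.smul_apply]
    simp [paretoScore] at this ⊢
    rw [this]

/-- The point `x = α`, where the density jumps as the first parameter varies, is discarded as a null
set. -/
theorem fisherRaoIntegrand_paretoDensity_ae {α β : ℝ} (hα : 0 < α) (hβ : 0 < β) (i j : Fin 2) :
    fisherRaoIntegrand paretoDensity !₂[α, β] i j =ᵐ[volume] (Ioi α).indicator
      fun x => paretoScore α β i x * paretoScore α β j x *
        (β / x * Real.exp (-β * (Real.log x - Real.log α))) := by
  filter_upwards [compl_mem_ae_iff.2 (measure_singleton (μ := volume) α)] with x hx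
  rcases lt_or_gt_of_ne (show x ≠ α from hx) with h | h
  · rw [indicator_of_notMem (by simpa using h.le)]
    simp [fisherRaoIntegrand, paretoDensity, paretoPDFReal, h]
  · rw [indicator_of_mem (by simpa using h), fisherRaoIntegrand,
      lineDeriv_log_paretoDensity hα hβ h, lineDeriv_log_paretoDensity hα hβ h,
      ← paretoPDFReal_eq_exp hα (le_of_lt h)]
    simp [paretoDensity]

theorem tendsto_log_pow_mul_exp {α β : ℝ} (hβ : 0 < β) (n : ℕ) :
    Tendsto (fun x => (Real.log x - Real.log α) ^ n *
      Real.exp (-β * (Real.log x - Real.log α))) atTop (𝓝 0) := by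
  have h := (tendsto_rpow_mul_exp_neg_mul_atTop_nhds_zero n β hβ).comp
    (tendsto_atTop_add_const_right _ (-Real.log α) Real.tendsto_log_atTop)
  simpa [Function.comp_def, ← sub_eq_add_neg] using h

/-- Source of all the primitives below: to integrate `r(u)` against the density, solve `q' - β q = β
r` and use `q(u) exp(-β u)`. -/
theorem hasDerivAt_mul_exp_log {α β x : ℝ} (hx : 0 < x) {q : ℝ → ℝ} {q' : ℝ}
    (hq : HasDerivAt q q' (Real.log x - Real.log α)) :
    HasDerivAt (fun y => q (Real.log y - Real.log α) *
        Real.exp (-β * (Real.log y - Real.log α)))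
      ((q' - β * q (Real.log x - Real.log α)) / x *
        Real.exp (-β * (Real.log x - Real.log α))) x := by
  have hl : HasDerivAt (fun y => Real.log y - Real.log α) x⁻¹ x :=
    (Real.hasDerivAt_log hx.ne').sub_const _
  refine ((hq.comp x hl).mul (hl.const_mul (-β)).exp).congr_deriv ?_
  simp only [Function.comp]
  ring

variable {α β : ℝ}

theorem integral_paretoScore_zero_zero (hα : 0 < α) (hβ : 0 < β) :
    IntegrableOn (fun x => β / x * Real.exp (-β * (Real.log x - Real.log α))) (Ioi α) ∧
    ∫ x in Ioi α, β / x * Real.exp (-β * (Real.log x - Real.log α)) = 1 := by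
  have hd : ∀ x ∈ Ici α, HasDerivAt
      (fun x => (-1 : ℝ) * Real.exp (-β * (Real.log x - Real.log α)))
      (β / x * Real.exp (-β * (Real.log x - Real.log α))) x := fun x hx => by
    convert hasDerivAt_mul_exp_log (α := α) (β := β) (hα.trans_le hx)
      (hasDerivAt_const _ (-1 : ℝ)) using 1
    ring
  have hp : ∀ x ∈ Ioi α, 0 ≤ β / x * Real.exp (-β * (Real.log x - Real.log α)) := fun x hx => by
    have : 0 < x := hα.trans hx
    positivity
  have ht := (tendsto_log_pow_mul_exp (α := α) hβ 0).const_mul (-1)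
  simp only [pow_zero, one_mul, mul_zero] at ht
  exact ⟨integrableOn_Ioi_deriv_of_nonneg' hd hp ht,
    by rw [integral_Ioi_of_hasDerivAt_of_nonneg' hd hp ht]; simp⟩

/-- The solution for `r = (1/β - u)²` is `q = -(u² + 1/β²)`. Since the integrand is nonnegative, the
limit of the primitive gives integrability as well as the value. -/
theorem integral_paretoScore_one_one (hα : 0 < α) (hβ : 0 < β) :
    IntegrableOn (fun x => (1 / β - (Real.log x - Real.log α)) ^ 2 *
      (β / x * Real.exp (-β * (Real.log x - Real.log α)))) (Ioi α) ∧
    ∫ x in Ioi α, (1 / β - (Real.log x - Real.log α)) ^ 2 *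
      (β / x * Real.exp (-β * (Real.log x - Real.log α))) = 1 / β ^ 2 := by
  have hd : ∀ x ∈ Ici α, HasDerivAt
      (fun x => (-((Real.log x - Real.log α) ^ 2 + 1 / β ^ 2)) *
        Real.exp (-β * (Real.log x - Real.log α)))
      ((1 / β - (Real.log x - Real.log α)) ^ 2 *
        (β / x * Real.exp (-β * (Real.log x - Real.log α)))) x := fun x hx => by
    convert hasDerivAt_mul_exp_log (α := α) (β := β) (hα.trans_le hx)
      (q := fun u => -(u ^ 2 + 1 / β ^ 2))
      (((hasDerivAt_pow 2 _).add_const (1 / β ^ 2)).neg) using 1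
    field_simp
    push_cast
    ring
  have hp : ∀ x ∈ Ioi α, 0 ≤ (1 / β - (Real.log x - Real.log α)) ^ 2 *
      (β / x * Real.exp (-β * (Real.log x - Real.log α))) := fun x hx => by
    have : 0 < x := hα.trans hx
    positivity
  have ht := ((tendsto_log_pow_mul_exp (α := α) hβ 2).add
    ((tendsto_log_pow_mul_exp (α := α) hβ 0).const_mul (1 / β ^ 2))).neg
  have ht : Tendsto (fun x => (-((Real.log x - Real.log α) ^ 2 + 1 / β ^ 2)) *
        Real.exp (-β * (Real.log x - Real.log α))) atTop (𝓝 0) := by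
    convert ht using 2 <;> ring
  exact ⟨integrableOn_Ioi_deriv_of_nonneg' hd hp ht,
    by rw [integral_Ioi_of_hasDerivAt_of_nonneg' hd hp ht]; simp⟩

/-- Here `q = u`, which vanishes at `u = 0`, and `u exp(-β u)` tends to `0`. The integrand changes
sign, so integrability is obtained separately, from `|s| ≤ 1 + s²` and the two previous integrals.
-/
theorem integral_paretoScore_zero_one (hα : 0 < α) (hβ : 0 < β) :
    IntegrableOn (fun x => (1 / β - (Real.log x - Real.log α)) *
      (β / x * Real.exp (-β * (Real.log x - Real.log α)))) (Ioi α) ∧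
    ∫ x in Ioi α, (1 / β - (Real.log x - Real.log α)) *
      (β / x * Real.exp (-β * (Real.log x - Real.log α))) = 0 := by
  have hd : ∀ x ∈ Ici α, HasDerivAt
      (fun x => (Real.log x - Real.log α) * Real.exp (-β * (Real.log x - Real.log α)))
      ((1 / β - (Real.log x - Real.log α)) *
        (β / x * Real.exp (-β * (Real.log x - Real.log α)))) x := fun x hx => by
    convert hasDerivAt_mul_exp_log (α := α) (β := β) (hα.trans_le hx) (hasDerivAt_id' _) using 1
    field_simp
  have hi : IntegrableOn (fun x => (1 / β - (Real.log x - Real.log α)) *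
      (β / x * Real.exp (-β * (Real.log x - Real.log α)))) (Ioi α) := by
    refine ((integral_paretoScore_zero_zero hα hβ).1.add
      (integral_paretoScore_one_one hα hβ).1).mono' ?_ ?_
    · have : Measurable fun x => (1 / β - (Real.log x - Real.log α)) *
        (β / x * Real.exp (-β * (Real.log x - Real.log α))) := by fun_prop
      exact this.aestronglyMeasurable
    · filter_upwards [ae_restrict_mem measurableSet_Ioi] with x hx
      have hx : 0 < x := hα.trans hx
      have hp : 0 ≤ β / x * Real.exp (-β * (Real.log x - Real.log α)) := by positivity
      rw [Real.norm_eq_abs, abs_mul, abs_of_nonneg hp, Pi.add_apply, ← one_add_mul]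
      refine mul_le_mul_of_nonneg_right ?_ hp
      rw [← sq_abs (1 / β - (Real.log x - Real.log α))]
      nlinarith [sq_nonneg (|1 / β - (Real.log x - Real.log α)| - 1)]
  have ht := tendsto_log_pow_mul_exp (α := α) hβ 1
  simp only [pow_one] at ht
  exact ⟨hi, by rw [integral_Ioi_of_hasDerivAt_of_tendsto' hd hi ht]; simp⟩

theorem integral_paretoScore_mul (hα : 0 < α) (hβ : 0 < β) (i j : Fin 2) :
    IntegrableOn (fun x => paretoScore α β i x * paretoScore α β j x *
        (β / x * Real.exp (-β * (Real.log x - Real.log α)))) (Ioi α) ∧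
    ∫ x in Ioi α, paretoScore α β i x * paretoScore α β j x *
        (β / x * Real.exp (-β * (Real.log x - Real.log α))) =
      !![β ^ 2 / α ^ 2, 0; 0, 1 / β ^ 2] i j := by
  -- The first score is the constant `β / α`, so each entry is a constant times one of the three
  -- integrals above.
  have key {f f₀ : ℝ → ℝ} {c a : ℝ} (h : IntegrableOn f₀ (Ioi α) ∧ ∫ x in Ioi α, f₀ x = a)
      (hf : f = fun x => c * f₀ x) : IntegrableOn f (Ioi α) ∧ ∫ x in Ioi α, f x = c * a := by
    subst hf
    exact ⟨h.1.const_mul c, by rw [integral_const_mul, h.2]⟩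
  fin_cases i <;> fin_cases j
  · convert key (c := β ^ 2 / α ^ 2) (integral_paretoScore_zero_zero hα hβ) _ using 2
    · simp
    · ext x; simp only [paretoScore, Fin.zero_eta, Matrix.cons_val_zero]; ring
  · convert key (c := β / α) (integral_paretoScore_zero_one hα hβ) _ using 2
    · simp
    · ext x; simp [paretoScore]; ring
  · convert key (c := β / α) (integral_paretoScore_zero_one hα hβ) _ using 2
    · simp
    · ext x; simp [paretoScore]; ring
  · convert key (c := 1) (integral_paretoScore_one_one hα hβ) _ using 2
    · simp
    · ext x; simp only [paretoScore, Fin.mk_one, Matrix.cons_val_one, Matrix.cons_val_zero]; ring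

theorem integrable_fisherRaoIntegrand_paretoDensity (hα : 0 < α) (hβ : 0 < β) (i j : Fin 2) :
    Integrable (fisherRaoIntegrand paretoDensity !₂[α, β] i j) := by
  rw [integrable_congr (fisherRaoIntegrand_paretoDensity_ae hα hβ i j),
    integrable_indicator_iff measurableSet_Ioi]
  exact (integral_paretoScore_mul hα hβ i j).1

theorem fisherRaoMatrix_paretoDensity (hα : 0 < α) (hβ : 0 < β) :
    fisherRaoMatrix paretoDensity !₂[α, β] = !![β ^ 2 / α ^ 2, 0; 0, 1 / β ^ 2] := by
  ext i j
  rw [fisherRaoMatrix, Matrix.of_apply,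
    integral_congr_ae (fisherRaoIntegrand_paretoDensity_ae hα hβ i j),
    integral_indicator measurableSet_Ioi]
  exact (integral_paretoScore_mul hα hβ i j).2

end FisherRao

/-! ### Geodesic distance in the upper half-plane -/

theorem UpperHalfPlane.hasMFDerivAt_coe (z : ℍ) :
    HasMFDerivAt 𝓘(ℝ, ℂ) 𝓘(ℝ, ℂ) UpperHalfPlane.coe z (ContinuousLinearMap.id ℝ ℂ) :=
  UpperHalfPlane.isOpenEmbedding_coe.hasMFDerivAt z

theorem UpperHalfPlane.contMDiff_real_coe {n : ℕ∞ω} :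
    ContMDiff 𝓘(ℝ, ℂ) 𝓘(ℝ, ℂ) n UpperHalfPlane.coe :=
  contMDiff_isOpenEmbedding UpperHalfPlane.isOpenEmbedding_coe

theorem halfPlaneTangentCoords_mfderiv {E H M : Type*} [NormedAddCommGroup E] [NormedSpace ℝ E]
    [TopologicalSpace H] {I : ModelWithCorners ℝ E H} [TopologicalSpace M] [ChartedSpace H M]
    {G : M → ℍ} {x : M} (hG : MDifferentiableAt I 𝓘(ℝ, ℂ) G x) (v : TangentSpace I x) :
    halfPlaneTangentCoords (mfderiv I 𝓘(ℝ, ℂ) G x v) =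
      mfderiv I 𝓘(ℝ, ℂ) (UpperHalfPlane.coe ∘ G) x v := by
  rw [((UpperHalfPlane.hasMFDerivAt_coe (G x)).comp x hG.hasMFDerivAt).mfderiv]
  rfl

theorem poincareForm_self (z : ℍ) (v : TangentSpace 𝓘(ℝ, ℂ) z) :
    poincareForm z v v = (‖halfPlaneTangentCoords v‖ / z.im) ^ 2 := by
  rw [poincareForm, div_pow, Complex.sq_norm, Complex.normSq_apply]

theorem re_ofReal_add_ofReal_mul_I (a b : ℝ) : ((a : ℂ) + (b : ℂ) * Complex.I).re = a := by
  simp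

theorem im_ofReal_add_ofReal_mul_I (a b : ℝ) : ((a : ℂ) + (b : ℂ) * Complex.I).im = b := by
  simp

/-- A unit speed curve `Φ` in the upper half-plane is length minimizing if some function `φ` with
gradient of norm at most one inverts it. -/
theorem geodesicEDist_poincareForm_of_calibration {Φ Φ' : ℝ → ℂ} {φ : ℂ → ℝ}
    (hΦ : ContDiff ℝ 1 Φ) (hpos : ∀ s, 0 < (Φ s).im) (hΦd : ∀ s, HasDerivAt Φ (Φ' s) s)
    (hΦn : ∀ s, ‖Φ' s‖ ≤ (Φ s).im) (hφ : ∀ z : ℂ, 0 < z.im → ContDiffAt ℝ 1 φ z)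
    (hφn : ∀ z : ℂ, 0 < z.im → ∀ v, |fderiv ℝ φ z v| ≤ ‖v‖ / z.im) (hinv : ∀ s, φ (Φ s) = s)
    {z w : ℍ} {s t : ℝ} (hz : Φ s = z) (hw : Φ t = w) :
    geodesicEDist 𝓘(ℝ, ℂ) poincareForm z w = edist s t := by
  -- Upper bound: `Φ` is a contraction from `ℝ` to the half-plane. Lower bound: `φ` is a contraction
  -- back.
  apply le_antisymm
  · let G : ℝ → ℍ := fun s => ⟨Φ s, hpos s⟩
    have hG : ContMDiff 𝓘(ℝ, ℝ) 𝓘(ℝ, ℂ) 1 G :=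
      ContMDiff.of_comp_isOpenEmbedding UpperHalfPlane.isOpenEmbedding_coe
        (contMDiff_iff_contDiff.2 hΦ)
    have h := geodesicEDist_le_of_mfderiv_le realForm poincareForm hG (fun u v => ?_) s t
    · rwa [geodesicEDist_realForm, show G s = z from UpperHalfPlane.ext hz,
        show G t = w from UpperHalfPlane.ext hw] at h
    · rw [poincareForm_self, halfPlaneTangentCoords_mfderiv (hG.mdifferentiableAt one_ne_zero)]
      have hd : mfderiv 𝓘(ℝ, ℝ) 𝓘(ℝ, ℂ) (UpperHalfPlane.coe ∘ G) u =
          ContinuousLinearMap.toSpanSingleton ℝ (Φ' u) := by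
        rw [mfderiv_eq_fderiv]
        exact (hΦd u).hasFDerivAt.fderiv
      have key (v : ℝ) : (‖v • Φ' u‖ / (Φ u).im) ^ 2 ≤ v * v := by
        have := hpos u
        rw [norm_smul, Real.norm_eq_abs, ← sq, ← sq_abs v]
        refine pow_le_pow_left₀ (by positivity) ?_ 2
        rw [div_le_iff₀ this]
        exact mul_le_mul_of_nonneg_left (hΦn u) (abs_nonneg v)
      rw [hd]
      exact key v
  · have hf : ContMDiff 𝓘(ℝ, ℂ) 𝓘(ℝ, ℝ) 1 (φ ∘ UpperHalfPlane.coe) := fun p =>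
      (hφ p p.im_pos).contMDiffAt.comp p UpperHalfPlane.contMDiff_real_coe.contMDiffAt
    have h := geodesicEDist_le_of_mfderiv_le poincareForm realForm hf (fun p v => ?_) z w
    · rwa [geodesicEDist_realForm, Function.comp_apply, Function.comp_apply, ← hz, ← hw, hinv,
        hinv] at h
    · have hd : HasMFDerivAt 𝓘(ℝ, ℂ) 𝓘(ℝ, ℝ) (φ ∘ UpperHalfPlane.coe) p
          ((fderiv ℝ φ p).comp (ContinuousLinearMap.id ℝ ℂ)) :=
        HasMFDerivAt.comp p
          ((hφ p p.im_pos).differentiableAt one_ne_zero).hasFDerivAt.hasMFDerivAt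
          (UpperHalfPlane.hasMFDerivAt_coe p)
      have key (v : ℂ) : fderiv ℝ φ p v * fderiv ℝ φ p v ≤ (‖v‖ / p.im) ^ 2 := by
        rw [← sq, ← sq_abs]
        gcongr
        exact hφn p p.im_pos v
      rw [poincareForm_self, hd.mfderiv]
      exact key v

/-- Vertical half-lines are geodesics. -/
theorem geodesicEDist_poincareForm_of_re_eq {z w : ℍ} (h : z.re = w.re) :
    geodesicEDist 𝓘(ℝ, ℂ) poincareForm z w = edist (Real.log z.im) (Real.log w.im) := by
  have him (p : ℂ) (hp : 0 < p.im) :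
      HasFDerivAt (fun q : ℂ => Real.log q.im) (p.im⁻¹ • Complex.imCLM) p :=
    Complex.imCLM.hasFDerivAt.log hp.ne'
  -- The height alone calibrates: `φ = log y` has differential `dy / y`, and `|dy(v)| ≤ ‖v‖`.
  refine geodesicEDist_poincareForm_of_calibration
    (Φ := fun s => (z.re : ℂ) + (Real.exp s : ℂ) * Complex.I)
    (Φ' := fun s => (Real.exp s : ℂ) * Complex.I) (φ := fun q => Real.log q.im)
    ?_ (fun s => ?_) (fun s => ?_) (fun s => ?_) (fun p hp => ?_) (fun p hp v => ?_)
    (fun s => ?_) ?_ ?_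
  · exact contDiff_const.add ((Complex.ofRealCLM.contDiff.comp Real.contDiff_exp).mul
      contDiff_const)
  · rw [im_ofReal_add_ofReal_mul_I]
    exact Real.exp_pos s
  · exact ((Real.hasDerivAt_exp s).ofReal_comp.mul_const _).const_add _
  · simp [-Complex.ofReal_exp]
  · exact Complex.imCLM.contDiff.contDiffAt.log hp.ne'
  · rw [(him p hp).fderiv]
    simp only [smul_apply, Complex.imCLM_apply, smul_eq_mul, abs_mul,
      abs_inv, abs_of_pos hp]
    rw [inv_mul_eq_div]
    gcongr
    exact Complex.abs_im_le_norm v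
  · simp [-Complex.ofReal_exp]
  · rw [Real.exp_log z.im_pos]
    apply Complex.ext <;> simp
  · rw [Real.exp_log w.im_pos, h]
    apply Complex.ext <;> simp

theorem cosh_arsinh_div {x y r : ℝ} (hy : 0 < y) (hr : 0 < r) (h : x ^ 2 + y ^ 2 = r ^ 2) :
    Real.cosh (Real.arsinh (x / y)) = r / y := by
  rw [Real.cosh_arsinh, Real.sqrt_eq_iff_mul_self_eq (by positivity) (by positivity)]
  field_simp
  linarith

/-- The distance along half-circles of center `c` and radius `r`. -/
theorem geodesicEDist_poincareForm_of_mem_circle {z w : ℍ} {c r : ℝ} (hr : 0 < r)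
    (hz : (z.re - c) ^ 2 + z.im ^ 2 = r ^ 2) (hw : (w.re - c) ^ 2 + w.im ^ 2 = r ^ 2) :
    geodesicEDist 𝓘(ℝ, ℂ) poincareForm z w =
      edist (Real.arsinh ((z.re - c) / z.im)) (Real.arsinh ((w.re - c) / w.im)) := by
  have hC (s : ℝ) : 0 < Real.cosh s := Real.cosh_pos s
  have hmem (p : ℂ) (hp : 0 < p.im) (a : ℝ) : p - a ∈ Complex.slitPlane :=
    Or.inr (by simpa using hp.ne')
  -- The calibrating function is `log (|q - a| / |q - b|)`, with `a = c - r` and `b = c + r` the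
  -- ends of the half-circle. As the real part of a holomorphic function, its gradient is bounded
  -- through the modulus of the complex derivative.
  have hφd (p : ℂ) (hp : 0 < p.im) : HasFDerivAt
      (fun q : ℂ => (Complex.log (q - (c - r : ℝ)) - Complex.log (q - (c + r : ℝ))).re)
      (Complex.reCLM.comp ((ContinuousLinearMap.toSpanSingleton ℂ
        (1 / (p - (c - r : ℝ)) - 1 / (p - (c + r : ℝ)))).restrictScalars ℝ)) p := by
    have h1 := ((hasDerivAt_id p).sub_const ((c - r : ℝ) : ℂ)).clog (hmem p hp _)
    have h2 := ((hasDerivAt_id p).sub_const ((c + r : ℝ) : ℂ)).clog (hmem p hp _)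
    exact Complex.reCLM.hasFDerivAt.comp p ((h1.sub h2).hasFDerivAt.restrictScalars ℝ)
  have hpt (p : ℍ) (hp : (p.re - c) ^ 2 + p.im ^ 2 = r ^ 2) :
      ((c + r * (Real.sinh (Real.arsinh ((p.re - c) / p.im)) /
        Real.cosh (Real.arsinh ((p.re - c) / p.im))) : ℝ) : ℂ) +
        ((r / Real.cosh (Real.arsinh ((p.re - c) / p.im)) : ℝ) : ℂ) * Complex.I = p := by
    have hi := p.im_pos
    rw [cosh_arsinh_div hi hr hp, Real.sinh_arsinh]
    apply Complex.ext
    · rw [re_ofReal_add_ofReal_mul_I, UpperHalfPlane.coe_re]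
      field_simp
      ring
    · rw [im_ofReal_add_ofReal_mul_I, UpperHalfPlane.coe_im]
      field_simp
  -- Unit speed parametrization `(c + r tanh s, r / cosh s)`; a point `(x, y)` of the half-circle
  -- has `sinh s = (x - c) / y`.
  refine geodesicEDist_poincareForm_of_calibration
    (Φ := fun s => ((c + r * (Real.sinh s / Real.cosh s) : ℝ) : ℂ) +
      ((r / Real.cosh s : ℝ) : ℂ) * Complex.I)
    (Φ' := fun s => ((r * (1 / Real.cosh s ^ 2) : ℝ) : ℂ) +
      ((-r * Real.sinh s / Real.cosh s ^ 2 : ℝ) : ℂ) * Complex.I)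
    (φ := fun q => (Complex.log (q - (c - r : ℝ)) - Complex.log (q - (c + r : ℝ))).re)
    ?_ (fun s => ?_) (fun s => ?_) (fun s => ?_) (fun p hp => ?_) (fun p hp v => ?_)
    (fun s => ?_) (hpt z hz) (hpt w hw)
  · refine ContDiff.add (Complex.ofRealCLM.contDiff.comp ?_)
      ((Complex.ofRealCLM.contDiff.comp ?_).mul contDiff_const)
    · exact contDiff_const.add (contDiff_const.mul
        (Real.contDiff_sinh.div Real.contDiff_cosh fun s => (hC s).ne'))
    · exact contDiff_const.div Real.contDiff_cosh fun s => (hC s).ne'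
  · rw [im_ofReal_add_ofReal_mul_I]
    exact div_pos hr (hC s)
  · have h1 : HasDerivAt (fun s => c + r * (Real.sinh s / Real.cosh s))
        (r * (1 / Real.cosh s ^ 2)) s := by
      refine ((((Real.hasDerivAt_sinh s).div (Real.hasDerivAt_cosh s) (hC s).ne').const_mul
        r).const_add c).congr_deriv ?_
      rw [← Real.cosh_sq_sub_sinh_sq s]
      ring
    have h2 : HasDerivAt (fun s => r / Real.cosh s) (-r * Real.sinh s / Real.cosh s ^ 2) s := by
      refine ((hasDerivAt_const s r).div (Real.hasDerivAt_cosh s) (hC s).ne').congr_deriv ?_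
      ring
    exact h1.ofReal_comp.add (h2.ofReal_comp.mul_const Complex.I)
  · have h3 := Real.cosh_sq s
    have h4 := hC s
    rw [Complex.norm_add_mul_I]
    apply Real.sqrt_le_iff.2
    simp only [Complex.add_im, Complex.ofReal_im, Complex.mul_im, Complex.ofReal_re, Complex.I_im,
      Complex.I_re, mul_zero, mul_one, zero_add, add_zero]
    refine ⟨by positivity, le_of_eq ?_⟩
    field_simp
    rw [h3]
    ring
  · refine Complex.reCLM.contDiff.contDiffAt.comp p (ContDiffAt.sub ?_ ?_)
    · exact ((Complex.contDiffAt_log (hmem p hp _)).comp p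
        (contDiffAt_id.sub contDiffAt_const)).restrict_scalars ℝ
    · exact ((Complex.contDiffAt_log (hmem p hp _)).comp p
        (contDiffAt_id.sub contDiffAt_const)).restrict_scalars ℝ
  · rw [(hφd p hp).fderiv]
    have ha : p - (c - r : ℝ) ≠ 0 := Complex.slitPlane_ne_zero (hmem p hp _)
    have hb : p - (c + r : ℝ) ≠ 0 := Complex.slitPlane_ne_zero (hmem p hp _)
    -- The claim amounts to `2 r y ≤ |p - a| |p - b|`: twice the area of the triangle `a`, `b`, `p`
    -- is at most the product of two sides. After squaring, the difference is the square of the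
    -- inner product of these sides.
    have hgrad : ‖1 / (p - (c - r : ℝ)) - 1 / (p - (c + r : ℝ))‖ ≤ 1 / p.im := by
      rw [div_sub_div _ _ ha hb, norm_div, div_le_div_iff₀ (norm_pos_iff.2 (mul_ne_zero ha hb)) hp, one_mul,
        one_mul, mul_one, show (p - (c + r : ℝ)) - (p - (c - r : ℝ)) = ((-(2 * r) : ℝ) : ℂ) by
          push_cast; ring,
        Complex.norm_real, Real.norm_eq_abs, abs_neg, abs_of_pos (by positivity)]
      refine le_of_sq_le_sq ?_ (norm_nonneg _)
      rw [Complex.sq_norm, Complex.normSq_mul, Complex.normSq_apply, Complex.normSq_apply]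
      simp only [Complex.sub_re, Complex.sub_im, Complex.ofReal_re, Complex.ofReal_im]
      nlinarith [sq_nonneg ((p.re - (c - r)) * (p.re - (c + r)) + p.im ^ 2)]
    calc _ ≤ ‖v • (1 / (p - (c - r : ℝ)) - 1 / (p - (c + r : ℝ)))‖ :=
          Complex.abs_re_le_norm _
      _ ≤ ‖v‖ * (1 / p.im) := by
          rw [norm_smul]
          exact mul_le_mul_of_nonneg_left hgrad (norm_nonneg _)
      _ = ‖v‖ / p.im := by ring
  · have hp : 0 < (((c + r * (Real.sinh s / Real.cosh s) : ℝ) : ℂ) +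
        ((r / Real.cosh s : ℝ) : ℂ) * Complex.I).im := by
      rw [im_ofReal_add_ofReal_mul_I]
      exact div_pos hr (hC s)
    rw [Complex.sub_re, Complex.log_re, Complex.log_re, sub_eq_iff_eq_add]
    have hb : 0 < ‖((c + r * (Real.sinh s / Real.cosh s) : ℝ) : ℂ) +
        ((r / Real.cosh s : ℝ) : ℂ) * Complex.I - (c + r : ℝ)‖ :=
      norm_pos_iff.2 (Complex.slitPlane_ne_zero (hmem _ hp _))
    -- This reduces `φ (Φ s) = s` to `|Φ s - a| = exp s * |Φ s - b|`, which is then squared.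
    rw [← Real.log_exp s, ← Real.log_mul (Real.exp_pos _).ne' (by rw [Real.log_exp]; exact hb.ne'),
      Real.log_exp]
    congr 1
    rw [← sq_eq_sq₀ (norm_nonneg _) (by positivity), mul_pow, Complex.sq_norm, Complex.sq_norm,
      Complex.normSq_apply, Complex.normSq_apply]
    simp only [Complex.sub_re, Complex.sub_im, Complex.ofReal_re, Complex.ofReal_im,
      Complex.add_re, Complex.add_im, Complex.mul_re, Complex.mul_im, Complex.I_re, Complex.I_im,
      mul_zero, mul_one, zero_add, add_zero, sub_zero]
    rw [← Real.cosh_add_sinh]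
    have h3 := Real.cosh_sq s
    have h4 := hC s
    field_simp
    have h5 : (Real.cosh s + Real.sinh s) * (Real.cosh s - Real.sinh s) = 1 := by
      linear_combination h3
    linear_combination
      r ^ 2 * (-1 - (Real.cosh s + Real.sinh s) * (Real.cosh s - Real.sinh s)) * h5

/-- Passing to `cosh (s - t)` lets the addition formula eliminate the arc parameters. -/
theorem edist_eq_ofReal_arcosh (s t : ℝ) :
    edist s t = ENNReal.ofReal (Real.arcosh (Real.cosh (s - t))) := by
  rw [edist_dist, Real.dist_eq, ← Real.cosh_abs, Real.arcosh_cosh (abs_nonneg _)]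

/-- The geodesic distance of the Poincaré metric. -/
theorem geodesicEDist_poincareForm (z w : ℍ) :
    geodesicEDist 𝓘(ℝ, ℂ) poincareForm z w = ENNReal.ofReal (Real.arcosh
      (1 + ((z.re - w.re) ^ 2 + (z.im - w.im) ^ 2) / (2 * z.im * w.im))) := by
  have hz := z.im_pos
  have hw := w.im_pos
  rcases eq_or_ne z.re w.re with h | h
  · rw [geodesicEDist_poincareForm_of_re_eq h, edist_eq_ofReal_arcosh, Real.cosh_eq, neg_sub,
      Real.exp_sub, Real.exp_sub, Real.exp_log hz, Real.exp_log hw, h]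
    congr 2
    field_simp
    ring
  · have h0 : z.re - w.re ≠ 0 := sub_ne_zero.2 h
    -- The centre is where the perpendicular bisector of the two points meets the real axis; it
    -- exists because the real parts differ.
    obtain ⟨c, hc⟩ : ∃ c, (z.re - c) ^ 2 + z.im ^ 2 = (w.re - c) ^ 2 + w.im ^ 2 :=
      ⟨(z.re ^ 2 + z.im ^ 2 - w.re ^ 2 - w.im ^ 2) / (2 * (z.re - w.re)), by field_simp; ring⟩
    obtain ⟨r, hr, hrz⟩ : ∃ r, 0 < r ∧ r ^ 2 = (z.re - c) ^ 2 + z.im ^ 2 :=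
      ⟨√((z.re - c) ^ 2 + z.im ^ 2), by positivity, Real.sq_sqrt (by positivity)⟩
    rw [geodesicEDist_poincareForm_of_mem_circle hr hrz.symm (hc ▸ hrz.symm),
      edist_eq_ofReal_arcosh, Real.cosh_sub, cosh_arsinh_div hz hr hrz.symm,
      cosh_arsinh_div hw hr (hc ▸ hrz.symm), Real.sinh_arsinh, Real.sinh_arsinh]
    congr 2
    field_simp
    -- Adding the two circle equations replaces `2 r²` and thereby removes `r` and `c`.
    linear_combination hrz + (hrz.trans hc)

/-! ### The isometry between the Pareto family and the upper half-plane -/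

namespace ParetoFamily

theorem hasMFDerivAt_coords (p : ParetoFamily) :
    HasMFDerivAt 𝓘(ℝ, EuclideanSpace ℝ (Fin 2)) 𝓘(ℝ, EuclideanSpace ℝ (Fin 2)) coords p
      (ContinuousLinearMap.id ℝ (EuclideanSpace ℝ (Fin 2))) :=
  isOpenEmbedding_coords.hasMFDerivAt p

theorem contMDiff_coords {n : ℕ∞ω} :
    ContMDiff 𝓘(ℝ, EuclideanSpace ℝ (Fin 2)) 𝓘(ℝ, EuclideanSpace ℝ (Fin 2)) n coords :=
  contMDiff_isOpenEmbedding isOpenEmbedding_coords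

/-- The map `(α, β) ↦ log α + i / β` in coordinates. -/
def coordsToComplex (θ : EuclideanSpace ℝ (Fin 2)) : ℂ :=
  (Real.log (θ 0) : ℂ) + ((θ 1)⁻¹ : ℝ) * Complex.I

theorem contDiffAt_coordsToComplex {n : ℕ∞ω} {θ : EuclideanSpace ℝ (Fin 2)}
    (hθ : θ ∈ paretoParams) : ContDiffAt ℝ n coordsToComplex θ := by
  have h (i : Fin 2) : ContDiffAt ℝ n (fun η : EuclideanSpace ℝ (Fin 2) => η i) θ :=
    (EuclideanSpace.proj (𝕜 := ℝ) i).contDiff.contDiffAt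
  exact (Complex.ofRealCLM.contDiff.contDiffAt.comp θ ((h 0).log hθ.1.ne')).add
    ((Complex.ofRealCLM.contDiff.contDiffAt.comp θ ((h 1).inv hθ.2.ne')).mul contDiffAt_const)

theorem fderiv_coordsToComplex {θ : EuclideanSpace ℝ (Fin 2)} (hθ : θ ∈ paretoParams)
    (v : EuclideanSpace ℝ (Fin 2)) :
    fderiv ℝ coordsToComplex θ v =
      ((v 0 / θ 0 : ℝ) : ℂ) + ((-v 1 / θ 1 ^ 2 : ℝ) : ℂ) * Complex.I := by
  have h (i : Fin 2) : HasFDerivAt (fun η : EuclideanSpace ℝ (Fin 2) => η i)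
      (EuclideanSpace.proj (𝕜 := ℝ) i) θ := (EuclideanSpace.proj (𝕜 := ℝ) i).hasFDerivAt
  have h0 := Complex.ofRealCLM.hasFDerivAt.comp θ ((h 0).log hθ.1.ne')
  have h1 := Complex.ofRealCLM.hasFDerivAt.comp θ
    ((hasDerivAt_inv hθ.2.ne').hasFDerivAt.comp θ (h 1))
  have := (h0.add (h1.mul_const Complex.I)).fderiv
  refine (congrArg (fun L : EuclideanSpace ℝ (Fin 2) →L[ℝ] ℂ => L v) this).trans ?_
  change (((θ 0)⁻¹ * v 0 : ℝ) : ℂ) + Complex.I * ((v 1 * -(θ 1 ^ 2)⁻¹ : ℝ) : ℂ) = _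
  push_cast
  ring

/-- The diffeomorphism `p_{α, β} ↦ log α + i / β` onto the upper half-plane. -/
def toHalfPlane :
    ParetoFamily ≃ₘ^∞⟮𝓘(ℝ, EuclideanSpace ℝ (Fin 2)), 𝓘(ℝ, ℂ)⟯ ℍ where
  toFun p := ⟨coordsToComplex p.coords, by
    rw [coordsToComplex, im_ofReal_add_ofReal_mul_I]
    exact inv_pos.2 p.coords_mem.2⟩
  invFun z := pareto (Real.exp z.re) z.im⁻¹ (Real.exp_pos _) (inv_pos.2 z.im_pos)
  left_inv p := by
    apply coords_injective
    rw [coords_pareto]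
    ext i
    fin_cases i
    · simp [UpperHalfPlane.re, coordsToComplex, Real.exp_log p.coords_mem.1]
    · simp [UpperHalfPlane.im, coordsToComplex]
  right_inv z := by
    apply UpperHalfPlane.ext
    simpa [coords_pareto, coordsToComplex] using Complex.re_add_im (z : ℂ)
  contMDiff_toFun := by
    refine ContMDiff.of_comp_isOpenEmbedding UpperHalfPlane.isOpenEmbedding_coe fun p => ?_
    exact (contDiffAt_coordsToComplex p.coords_mem).contMDiffAt.comp p contMDiff_coords.contMDiffAt
  contMDiff_invFun := by
    refine ContMDiff.of_comp_isOpenEmbedding isOpenEmbedding_coords fun z => ?_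
    have h : ContDiffAt ℝ ∞ (fun w : ℂ => !₂[Real.exp w.re, w.im⁻¹]) (z : ℂ) := by
      rw [contDiffAt_euclidean]
      intro i
      fin_cases i
      · exact Complex.reCLM.contDiff.contDiffAt.exp
      · exact Complex.imCLM.contDiff.contDiffAt.inv z.im_pos.ne'
    have heq : (coords ∘ fun w : ℍ =>
        pareto (Real.exp w.re) w.im⁻¹ (Real.exp_pos _) (inv_pos.2 w.im_pos)) =
        (fun w : ℂ => !₂[Real.exp w.re, w.im⁻¹]) ∘ UpperHalfPlane.coe :=
      funext fun w => coords_pareto _ _ (Real.exp_pos _) (inv_pos.2 w.im_pos)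
    exact (h.contMDiffAt.comp z
      UpperHalfPlane.contMDiff_real_coe.contMDiffAt).congr_of_eventuallyEq (.of_eq heq)

theorem coe_toHalfPlane (p : ParetoFamily) :
    (toHalfPlane p : ℂ) = coordsToComplex p.coords := rfl

theorem toHalfPlane_re (p : ParetoFamily) : (toHalfPlane p).re = Real.log (p.coords 0) := by
  rw [← UpperHalfPlane.coe_re, coe_toHalfPlane, coordsToComplex, re_ofReal_add_ofReal_mul_I]

theorem toHalfPlane_im (p : ParetoFamily) : (toHalfPlane p).im = (p.coords 1)⁻¹ := by
  rw [← UpperHalfPlane.coe_im, coe_toHalfPlane, coordsToComplex, im_ofReal_add_ofReal_mul_I]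

theorem halfPlaneTangentCoords_mfderiv_toHalfPlane (p : ParetoFamily)
    (v : TangentSpace 𝓘(ℝ, EuclideanSpace ℝ (Fin 2)) p) :
    halfPlaneTangentCoords
        (mfderiv 𝓘(ℝ, EuclideanSpace ℝ (Fin 2)) 𝓘(ℝ, ℂ) toHalfPlane p v) =
      ((tangentCoords v 0 / p.coords 0 : ℝ) : ℂ) +
        ((-tangentCoords v 1 / p.coords 1 ^ 2 : ℝ) : ℂ) * Complex.I := by
  have hF := toHalfPlane.contMDiff.mdifferentiableAt (x := p) (by simp)
  rw [halfPlaneTangentCoords_mfderiv hF, ← fderiv_coordsToComplex p.coords_mem (tangentCoords v)]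
  have h : HasMFDerivAt 𝓘(ℝ, EuclideanSpace ℝ (Fin 2)) 𝓘(ℝ, ℂ) (coordsToComplex ∘ coords) p
      ((fderiv ℝ coordsToComplex p.coords).comp
        (ContinuousLinearMap.id ℝ (EuclideanSpace ℝ (Fin 2)))) :=
    HasMFDerivAt.comp p ((contDiffAt_coordsToComplex (n := 1)
      p.coords_mem).differentiableAt one_ne_zero).hasFDerivAt.hasMFDerivAt (hasMFDerivAt_coords p)
  exact congrArg (fun L : EuclideanSpace ℝ (Fin 2) →L[ℝ] ℂ => L (tangentCoords v)) h.mfderiv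

/-- The Poincaré metric pulls back to the Fisher–Rao metric. -/
theorem poincareForm_mfderiv_toHalfPlane (p : ParetoFamily)
    (v w : TangentSpace 𝓘(ℝ, EuclideanSpace ℝ (Fin 2)) p) :
    poincareForm (toHalfPlane p)
        (mfderiv 𝓘(ℝ, EuclideanSpace ℝ (Fin 2)) 𝓘(ℝ, ℂ) toHalfPlane p v)
        (mfderiv 𝓘(ℝ, EuclideanSpace ℝ (Fin 2)) 𝓘(ℝ, ℂ) toHalfPlane p w) =
      fisherRaoForm p v w := by
  have h0 := p.coords_mem.1
  have h1 := p.coords_mem.2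
  have hm : fisherRaoMatrix paretoDensity p.coords =
      !![p.coords 1 ^ 2 / p.coords 0 ^ 2, 0; 0, 1 / p.coords 1 ^ 2] := by
    rw [← fisherRaoMatrix_paretoDensity h0 h1]
    congr 1
    ext i
    fin_cases i <;> rfl
  rw [poincareForm, halfPlaneTangentCoords_mfderiv_toHalfPlane,
    halfPlaneTangentCoords_mfderiv_toHalfPlane, re_ofReal_add_ofReal_mul_I,
    re_ofReal_add_ofReal_mul_I, im_ofReal_add_ofReal_mul_I, im_ofReal_add_ofReal_mul_I,
    toHalfPlane_im, fisherRaoForm, hm]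
  simp only [Fin.sum_univ_two, Matrix.of_apply, Matrix.cons_val', Matrix.cons_val_zero,
    Matrix.cons_val_one, Matrix.cons_val_fin_one, zero_mul, add_zero, zero_add]
  field_simp

/-- A diffeomorphism preserving the metrics contracts in both directions. -/
theorem geodesicEDist_toHalfPlane (p q : ParetoFamily) :
    geodesicEDist 𝓘(ℝ, EuclideanSpace ℝ (Fin 2)) fisherRaoForm p q =
      geodesicEDist 𝓘(ℝ, ℂ) poincareForm (toHalfPlane p) (toHalfPlane q) := by
  have hF : ContMDiff 𝓘(ℝ, EuclideanSpace ℝ (Fin 2)) 𝓘(ℝ, ℂ) 1 toHalfPlane :=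
    toHalfPlane.contMDiff.of_le (by simp)
  have hG : ContMDiff 𝓘(ℝ, ℂ) 𝓘(ℝ, EuclideanSpace ℝ (Fin 2)) 1 toHalfPlane.symm :=
    toHalfPlane.symm.contMDiff.of_le (by simp)
  refine le_antisymm ?_ (geodesicEDist_le_of_mfderiv_le _ _ hF
    (fun x v => (poincareForm_mfderiv_toHalfPlane x v v).le) p q)
  have h := geodesicEDist_le_of_mfderiv_le poincareForm fisherRaoForm hG (fun z v => ?_)
    (toHalfPlane p) (toHalfPlane q)
  · simpa using h
  · rw [← poincareForm_mfderiv_toHalfPlane]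
    -- Length preservation of the inverse follows from that of the map itself, by the chain rule for
    -- their composite.
    have hc : (mfderiv 𝓘(ℝ, EuclideanSpace ℝ (Fin 2)) 𝓘(ℝ, ℂ) toHalfPlane
        (toHalfPlane.symm z)).comp
        (mfderiv 𝓘(ℝ, ℂ) 𝓘(ℝ, EuclideanSpace ℝ (Fin 2)) toHalfPlane.symm z) =
        ContinuousLinearMap.id ℝ ℂ := by
      rw [← mfderiv_comp z (hF.mdifferentiableAt one_ne_zero) (hG.mdifferentiableAt one_ne_zero),
        show toHalfPlane ∘ toHalfPlane.symm = id from funext toHalfPlane.apply_symm_apply]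
      exact mfderiv_id
    have hv := congrArg (fun L : ℂ →L[ℝ] ℂ => L v) hc
    have hz := congrArg UpperHalfPlane.im (toHalfPlane.apply_symm_apply z)
    rw [poincareForm_self, poincareForm_self, hz]
    exact (congrArg (fun u : ℂ => (‖u‖ / z.im) ^ 2) hv).le

end ParetoFamily

end

theorem mainTheorem4 :
    (∀ α β : ℝ, 0 < α → 0 < β → ∀ i j : Fin 2,
      Integrable (fisherRaoIntegrand paretoDensity !₂[α, β] i j)) ∧
    ∃ F : ParetoFamily ≃ₘ^∞⟮𝓘(ℝ, EuclideanSpace ℝ (Fin 2)), 𝓘(ℝ, ℂ)⟯ ℍ,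
      (∀ (α β : ℝ) (hα : 0 < α) (hβ : 0 < β),
        (F (pareto α β hα hβ)).re = Real.log α ∧ (F (pareto α β hα hβ)).im = 1 / β) ∧
      (∀ (p : ParetoFamily) (v w : TangentSpace 𝓘(ℝ, EuclideanSpace ℝ (Fin 2)) p),
        poincareForm (F p)
            (mfderiv 𝓘(ℝ, EuclideanSpace ℝ (Fin 2)) 𝓘(ℝ, ℂ) F p v)
            (mfderiv 𝓘(ℝ, EuclideanSpace ℝ (Fin 2)) 𝓘(ℝ, ℂ) F p w) =
          fisherRaoForm p v w) ∧
      ∀ (α₀ β₀ α₁ β₁ : ℝ) (hα₀ : 0 < α₀) (hβ₀ : 0 < β₀) (hα₁ : 0 < α₁) (hβ₁ : 0 < β₁),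
        geodesicEDist 𝓘(ℝ, EuclideanSpace ℝ (Fin 2)) fisherRaoForm
            (pareto α₀ β₀ hα₀ hβ₀) (pareto α₁ β₁ hα₁ hβ₁) =
          geodesicEDist 𝓘(ℝ, ℂ) poincareForm
            (F (pareto α₀ β₀ hα₀ hβ₀)) (F (pareto α₁ β₁ hα₁ hβ₁)) ∧
        geodesicEDist 𝓘(ℝ, EuclideanSpace ℝ (Fin 2)) fisherRaoForm
            (pareto α₀ β₀ hα₀ hβ₀) (pareto α₁ β₁ hα₁ hβ₁) =
          ENNReal.ofReal (Real.arcosh (1 + β₀ * β₁ * (Real.log α₀ - Real.log α₁) ^ 2 / 2 +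
            (β₀ - β₁) ^ 2 / (2 * β₀ * β₁))) := by
  refine ⟨fun α β hα hβ => integrable_fisherRaoIntegrand_paretoDensity hα hβ,
    ParetoFamily.toHalfPlane, fun α β hα hβ => ?_,
    ParetoFamily.poincareForm_mfderiv_toHalfPlane, fun α₀ β₀ α₁ β₁ hα₀ hβ₀ hα₁ hβ₁ => ?_⟩
  · simp [ParetoFamily.toHalfPlane_re, ParetoFamily.toHalfPlane_im, ParetoFamily.coords_pareto]
  · refine ⟨ParetoFamily.geodesicEDist_toHalfPlane _ _, ?_⟩
    rw [ParetoFamily.geodesicEDist_toHalfPlane, geodesicEDist_poincareForm]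
    simp only [ParetoFamily.toHalfPlane_re, ParetoFamily.toHalfPlane_im,
      ParetoFamily.coords_pareto, PiLp.toLp_apply, Matrix.cons_val_zero, Matrix.cons_val_one]
    congr 2
    field_simp
    ring
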